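/- Graphs are finite and simple, and Hamiltonian cycles are counted as undirected cycles without a base point (i.e. as edge sets). For every integer $k \ge 0$ there exist (i) a $6$-regular graph on $39+7k$ vertices with exactly $2^{3(k+4)+1}\cdot 3^{k+4}\cdot 5^4$ Hamiltonian cycles, and (ii) a $7$-regular graph on $54+8k$ vertices with exactly $2^{3(k+7)}\cdot 3^{k+10}\cdot 5^{k+5}$ Hamiltonian cycles. -/

import Mathlib

/-- The Hamiltonian cycles of a simple graph `G`, as undirected cycles without a base point:
the edge sets of the closed walks that are Hamiltonian cycles. Different starting vertices and
the two directions of traversal give the same edge set, so each cycle is counted once. -/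
def hamiltonianCycles {V : Type*} [DecidableEq V] (G : SimpleGraph V) : Set (Set (Sym2 V)) :=
  {C | ∃ (v : V) (p : G.Walk v v), p.IsHamiltonianCycle ∧ p.edgeSet = C}

/-- The number of Hamiltonian cycles of a graph (finite when `V` is finite). -/
noncomputable def numHamiltonianCycles {V : Type*} [DecidableEq V] (G : SimpleGraph V) : ℕ :=
  (hamiltonianCycles G).ncard

/-! Call a graph with two terminals a gadget if all degrees are `d` except that the terminals have
degree `d - 1`. Joining two gadgets by two edges between their terminals gives a `d`-regular graph.
The two edges form a cut, so each Hamiltonian cycle uses both and consists of one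
terminal-to-terminal Hamiltonian path in each gadget: the counts multiply
(`numHamiltonianCycles_attachCopies`).

Gadgets are built by replacing edges with smaller gadgets. A Hamiltonian path with both ends outside
a copy must run through the whole copy in one pass, so a copy acts as an edge that has to be used,
and it contributes its own path count as a factor (`pathCount_attachCopies`).

For degree 6, `K₇` minus an edge has 5! = 120 paths. A chain of such blocks gains 7 vertices and a
factor 4! = 24 per link. An 11-vertex core with exactly two Hamiltonian paths through three
prescribed edges gives, after replacing these edges, a gadget with 2·120³ paths; it is joined to the
chain. Degree 7 is analogous, with `K₈`, 6! = 720, 5! = 120 and a 14-vertex core with four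
prescribed edges. The small counts are evaluated by the kernel through `jumpEval`. -/

open Finset

/-! ### Counting spanning paths by a recursion on the first step -/

section PathCount

variable {V : Type*} [DecidableEq V]

/-- The number of ways to continue from `u` through all the vertices of the `n`-element set `R`,
each visited exactly once, so as to end in `t`. -/
def pathCountAux (G : SimpleGraph V) [DecidableRel G.Adj] (t : V) : ℕ → Finset V → V → ℕ
  | 0, _, u => if u = t then 1 else 0
  | n + 1, R, u => ∑ v ∈ R with G.Adj u v, pathCountAux G t n (R.erase v) v

/-- The number of paths from `u` to `t` whose vertices other than `u` are those of `R`. -/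
def pathCount (G : SimpleGraph V) [DecidableRel G.Adj] (t : V) (R : Finset V) (u : V) : ℕ :=
  pathCountAux G t #R R u

variable {G : SimpleGraph V} [DecidableRel G.Adj] {t u : V} {R : Finset V}

lemma pathCount_empty : pathCount G t ∅ u = if u = t then 1 else 0 := rfl

lemma pathCount_of_nonempty (hR : R.Nonempty) :
    pathCount G t R u = ∑ v ∈ R with G.Adj u v, pathCount G t (R.erase v) v := by
  obtain ⟨n, hn⟩ := Nat.exists_eq_succ_of_ne_zero hR.card_pos.ne'
  unfold pathCount
  rw [hn, pathCountAux]
  refine sum_congr rfl fun v hv => ?_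
  rw [card_erase_of_mem (mem_filter.1 hv).1, hn, Nat.succ_sub_one]

/-- At least one step is taken, so the final vertex lies in `R`. -/
lemma pathCount_eq_zero_of_notMem (hR : R.Nonempty) (ht : t ∉ R) : pathCount G t R u = 0 := by
  induction h : #R using Nat.strong_induction_on generalizing R u with
  | _ n ih =>
    subst h
    rw [pathCount_of_nonempty hR]
    refine sum_eq_zero fun v hv => ?_
    obtain ⟨hv, -⟩ := mem_filter.1 hv
    rcases (R.erase v).eq_empty_or_nonempty with h | h
    · rw [h, pathCount_empty, if_neg]
      rintro rfl
      exact ht hv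
    · exact ih _ (card_erase_lt_of_mem hv) h (fun h' => ht (mem_of_mem_erase h')) rfl

/-- A set of vertices with no edges to the rest cannot be reached. -/
lemma pathCount_eq_zero_of_not_adj {A B : Finset V} (hA : A.Nonempty) (hAB : Disjoint A B)
    (h : ∀ a ∈ A, ∀ b ∈ insert u B, ¬ G.Adj b a) : pathCount G t (A ∪ B) u = 0 := by
  induction hn : #B using Nat.strong_induction_on generalizing B u with
  | _ n ih =>
    subst hn
    rw [pathCount_of_nonempty (hA.mono subset_union_left)]
    refine sum_eq_zero fun v hv => ?_
    obtain ⟨hv, huv⟩ := mem_filter.1 hv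
    have hvA : v ∉ A := fun hvA => h v hvA u (mem_insert_self _ _) huv
    have hvB : v ∈ B := (mem_union.1 hv).resolve_left hvA
    rw [erase_union_distrib, erase_eq_of_notMem hvA]
    refine ih _ (card_erase_lt_of_mem hvB) (hAB.mono_right (erase_subset _ _)) ?_ rfl
    rw [insert_erase hvB]
    exact fun a ha b hb => h a ha b (mem_insert_of_mem hb)

/-- If the only edge leaving `insert u A` towards `B` is `s y`, then a path from `u` through
`A ∪ B` first runs through `A`, leaves through `s y`, and then runs through `B`. -/
lemma pathCount_union {A B : Finset V} {s y : V} (hAB : Disjoint A B) (hu : u ∉ A) (hy : y ∈ B)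
    (h : ∀ a ∈ insert u A, ∀ b ∈ B, G.Adj a b ↔ a = s ∧ b = y) :
    pathCount G t (A ∪ B) u = pathCount G s A u * pathCount G t (B.erase y) y := by
  induction hn : #A using Nat.strong_induction_on generalizing A u with
  | _ n ih =>
    subst hn
    rw [pathCount_of_nonempty ⟨y, mem_union_right _ hy⟩, filter_union,
      sum_union (hAB.mono (filter_subset _ _) (filter_subset _ _))]
    have hB : ∑ v ∈ B with G.Adj u v, pathCount G t ((A ∪ B).erase v) v =
        if u = s then pathCount G t ((A ∪ B).erase y) y else 0 := by
      have : B.filter (G.Adj u) = if u = s then {y} else ∅ := by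
        ext v
        simp only [mem_filter]
        constructor
        · rintro ⟨hv, huv⟩
          obtain ⟨rfl, rfl⟩ := (h u (mem_insert_self _ _) v hv).1 huv
          simp
        · split_ifs with hus
          · intro hv
            rw [mem_singleton] at hv
            subst hv
            exact ⟨hy, (h u (mem_insert_self _ _) v hy).2 ⟨hus, rfl⟩⟩
          · simp
      rw [this]
      split_ifs <;> simp
    rw [hB]
    rcases A.eq_empty_or_nonempty with rfl | hA
    · simp [pathCount_empty]
    -- Crossing to `B` while `A` is nonempty strands `A`: the only edge back ends in `s = u`, which
    -- has already been visited.
    · have hz : (if u = s then pathCount G t ((A ∪ B).erase y) y else 0) = 0 := by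
        split_ifs with hus
        · have hyA : y ∉ A := fun hyA => disjoint_left.1 hAB hyA hy
          rw [erase_union_distrib, erase_eq_of_notMem hyA]
          refine pathCount_eq_zero_of_not_adj hA (hAB.mono_right (erase_subset _ _)) ?_
          rw [insert_erase hy]
          intro a ha b hb hba
          obtain ⟨rfl, -⟩ := (h a (mem_insert_of_mem ha) b hb).1 hba.symm
          exact hu (hus ▸ ha)
        · rfl
      rw [hz, add_zero, pathCount_of_nonempty hA, sum_mul]
      refine sum_congr rfl fun v hv => ?_
      obtain ⟨hvA, -⟩ := mem_filter.1 hv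
      rw [erase_union_distrib, erase_eq_of_notMem (disjoint_left.1 hAB hvA)]
      refine ih _ (card_erase_lt_of_mem hvA) (hAB.mono_left (erase_subset _ _))
        (notMem_erase _ _) ?_ rfl
      rw [insert_erase hvA]
      exact fun a ha => h a (mem_insert_of_mem ha)

/-- Only adjacency among the vertices involved matters, so a copy sitting inside a larger graph has
the same count. -/
lemma pathCount_map {W : Type*} [DecidableEq W] {G' : SimpleGraph W} [DecidableRel G'.Adj]
    (f : V ↪ W) (hf : ∀ a ∈ insert u R, ∀ b ∈ insert u R, G'.Adj (f a) (f b) ↔ G.Adj a b) :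
    pathCount G' (f t) (R.map f) (f u) = pathCount G t R u := by
  induction hn : #R using Nat.strong_induction_on generalizing R u with
  | _ n ih =>
    subst hn
    rcases R.eq_empty_or_nonempty with rfl | hR
    · simp [pathCount_empty]
    · rw [pathCount_of_nonempty hR, pathCount_of_nonempty (hR.map), filter_map, sum_map]
      have : R.filter ((G'.Adj (f u)) ∘ f) = R.filter (G.Adj u) :=
        filter_congr fun v hv => hf _ (mem_insert_self _ _) _ (mem_insert_of_mem hv)
      rw [this]
      refine sum_congr rfl fun v hv => ?_
      obtain ⟨hv, -⟩ := mem_filter.1 hv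
      rw [← map_erase]
      refine ih _ (card_erase_lt_of_mem hv) ?_ rfl
      rw [insert_erase hv]
      exact fun a ha b hb => hf a (mem_insert_of_mem ha) b (mem_insert_of_mem hb)

/-- The paths from `u` to `t` whose vertices other than `u` are those of `R`. -/
def SpanningPath (G : SimpleGraph V) (t : V) (R : Finset V) (u : V) : Type _ :=
  {p : G.Walk u t // p.IsPath ∧ ∀ v, v ∈ p.support ↔ v = u ∨ v ∈ R}

/-- Prepend an edge to a path. -/
def SpanningPath.cons (hu : u ∉ R) (x : Σ v : {v // v ∈ R.filter (G.Adj u)},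
    SpanningPath G t (R.erase v) v) : SpanningPath G t R u :=
  ⟨.cons (mem_filter.1 x.1.2).2 x.2.1, by
    obtain ⟨⟨v, hv⟩, p, hp, h⟩ := x
    obtain ⟨hvR, hadj⟩ := mem_filter.1 hv
    refine ⟨(SimpleGraph.Walk.cons_isPath_iff _ _).2 ⟨hp, ?_⟩, fun w => ?_⟩
    · rw [h]
      rintro (h | h)
      · exact hadj.ne h
      · exact hu (mem_of_mem_erase h)
    · simp only [SimpleGraph.Walk.support_cons, List.mem_cons]
      rw [h w]
      by_cases hw : w = v
      · subst hw; simp [hvR]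
      · simp [hw]⟩

lemma SpanningPath.cons_bijective (hu : u ∉ R) (hR : R.Nonempty) :
    Function.Bijective (SpanningPath.cons (G := G) (t := t) hu) := by
  constructor
  · rintro ⟨⟨v, hv⟩, p, hp⟩ ⟨⟨w, hw⟩, q, hq⟩ h
    have := congrArg Subtype.val h
    simp only [SpanningPath.cons, SimpleGraph.Walk.cons.injEq] at this
    obtain ⟨rfl, h⟩ := this
    rw [heq_eq_eq] at h
    subst h
    rfl
  · rintro ⟨p, hp, h⟩
    cases p with
    | nil =>
      obtain ⟨v, hv⟩ := hR
      have := (h v).2 (.inr hv)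
      simp only [SimpleGraph.Walk.support_nil, List.mem_singleton] at this
      exact (hu (this ▸ hv)).elim
    | @cons _ v _ hadj p =>
      have hvR : v ∈ R := ((h v).1 (by simp)).resolve_left hadj.ne'
      obtain ⟨hp, hup⟩ := (SimpleGraph.Walk.cons_isPath_iff _ _).1 hp
      refine ⟨⟨⟨v, mem_filter.2 ⟨hvR, hadj⟩⟩, p, hp, fun w => ?_⟩, rfl⟩
      have h1 := h w
      simp only [SimpleGraph.Walk.support_cons, List.mem_cons] at h1
      by_cases hw : w = v
      · subst hw; simp
      · by_cases hwu : w = u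
        · subst hwu; simp [hup, hu, hw]
        · simpa [hwu, hw] using h1

/-- Finiteness is carried through the induction because `Nat.card` is zero on infinite types, so
summing over first steps needs finite fibres. -/
lemma finite_and_pathCount_eq_card (hu : u ∉ R) :
    Finite (SpanningPath G t R u) ∧ pathCount G t R u = Nat.card (SpanningPath G t R u) := by
  induction hn : #R using Nat.strong_induction_on generalizing R u with
  | _ n ih =>
    subst hn
    rcases R.eq_empty_or_nonempty with rfl | hR
    · rw [pathCount_empty]
      split_ifs with h
      · subst h
        have hs : Subsingleton (SpanningPath G u ∅ u) := by
          constructor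
          rintro ⟨p, hp, -⟩ ⟨q, hq, -⟩
          exact Subtype.ext (((SimpleGraph.Walk.isPath_iff_nil.1 hp).eq_nil).trans
            (SimpleGraph.Walk.isPath_iff_nil.1 hq).eq_nil.symm)
        have hne : Nonempty (SpanningPath G u ∅ u) := ⟨⟨.nil, by simp⟩⟩
        exact ⟨inferInstance, (Nat.card_eq_one_iff_unique.2 ⟨hs, hne⟩).symm⟩
      · have : IsEmpty (SpanningPath G t ∅ u) := by
          constructor
          rintro ⟨p, -, hp⟩
          have := (hp t).1 p.end_mem_support
          simp [Ne.symm h] at this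
        exact ⟨inferInstance, Nat.card_of_isEmpty.symm⟩
    · rw [pathCount_of_nonempty hR]
      have ih' (v : {v // v ∈ R.filter (G.Adj u)}) :=
        ih _ (card_erase_lt_of_mem (mem_filter.1 v.2).1) (notMem_erase v.1 R) rfl
      have hfin (v : {v // v ∈ R.filter (G.Adj u)}) := (ih' v).1
      have hb := SpanningPath.cons_bijective (G := G) (t := t) hu hR
      refine ⟨Finite.of_surjective _ hb.2, ?_⟩
      rw [← Nat.card_congr (Equiv.ofBijective _ hb), Nat.card_sigma, ← sum_coe_sort]
      exact sum_congr rfl fun v _ => (ih' v).2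

lemma pathCount_univ_eq_card [Fintype V] : pathCount G t (univ.erase u) u =
    Nat.card {p : G.Walk u t // p.IsHamiltonian} := by
  rw [(finite_and_pathCount_eq_card (notMem_erase _ _)).2]
  refine Nat.card_congr (Equiv.subtypeEquivRight fun p => ?_)
  constructor
  · rintro ⟨hp, h⟩
    exact hp.isHamiltonian_of_mem fun w => (h w).2 (by simp [em])
  · intro hp
    exact ⟨hp.isPath, fun v => by simp [hp.mem_support v, em]⟩

/-- The recursion treats the two ends differently; symmetry comes from reversing actual paths. It
makes both directions through a gadget count the same. -/
lemma pathCount_symm [Fintype V] :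
    pathCount G t (univ.erase u) u = pathCount G u (univ.erase t) t := by
  rw [pathCount_univ_eq_card, pathCount_univ_eq_card]
  have (a b : V) (p : G.Walk a b) (hp : p.IsHamiltonian) : p.reverse.IsHamiltonian := by
    intro v
    rw [SimpleGraph.Walk.support_reverse, List.count_reverse, hp v]
  exact Nat.card_congr
    { toFun := fun p => ⟨p.1.reverse, this _ _ _ p.2⟩
      invFun := fun p => ⟨p.1.reverse, this _ _ _ p.2⟩
      left_inv := fun p => by simp
      right_inv := fun p => by simp }

end PathCount

/-! ### Spanning paths with compulsory extra edges, and their evaluation -/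

section JumpCount

variable {V ι : Type*} [DecidableEq V] [DecidableEq ι]

/-- Auxiliary form of `jumpCount`, by recursion on the number of vertices still to be visited. -/
def jumpCountAux (G : SimpleGraph V) [DecidableRel G.Adj] (x y : ι → V) (t : V) :
    ℕ → Finset V → Finset ι → V → ℕ
  | 0, _, J, v => if J = ∅ ∧ v = t then 1 else 0
  | n + 1, R, J, v => ∑ u ∈ R with G.Adj v u, jumpCountAux G x y t n (R.erase u) J u +
      ∑ j ∈ J, ((if v = x j ∧ y j ∈ R then
          jumpCountAux G x y t n (R.erase (y j)) (J.erase j) (y j) else 0) +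
        (if v = y j ∧ x j ∈ R then
          jumpCountAux G x y t n (R.erase (x j)) (J.erase j) (x j) else 0))

/-- The number of ways to continue from `v` through all the vertices of `R`, along edges of `G`
and along the extra edges `x j y j`, `j ∈ J`, using each extra edge exactly once, so as to end
in `t`. -/
def jumpCount (G : SimpleGraph V) [DecidableRel G.Adj] (x y : ι → V) (t : V)
    (R : Finset V) (J : Finset ι) (v : V) : ℕ :=
  jumpCountAux G x y t #R R J v

variable {G : SimpleGraph V} [DecidableRel G.Adj] {x y : ι → V} {t v : V} {R : Finset V}
  {J : Finset ι}

lemma jumpCount_empty : jumpCount G x y t ∅ J v = if J = ∅ ∧ v = t then 1 else 0 := rfl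

lemma jumpCount_of_nonempty (hR : R.Nonempty) :
    jumpCount G x y t R J v = ∑ u ∈ R with G.Adj v u, jumpCount G x y t (R.erase u) J u +
      ∑ j ∈ J, ((if v = x j ∧ y j ∈ R then
          jumpCount G x y t (R.erase (y j)) (J.erase j) (y j) else 0) +
        (if v = y j ∧ x j ∈ R then
          jumpCount G x y t (R.erase (x j)) (J.erase j) (x j) else 0)) := by
  obtain ⟨n, hn⟩ := Nat.exists_eq_succ_of_ne_zero hR.card_pos.ne'
  have h : ∀ u ∈ R, #(R.erase u) = n := fun u hu => by
    rw [card_erase_of_mem hu, hn, Nat.succ_sub_one]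
  unfold jumpCount
  rw [hn, jumpCountAux]
  congr 1
  · exact sum_congr rfl fun u hu => by rw [h u (mem_filter.1 hu).1]
  · refine sum_congr rfl fun j _ => ?_
    congr 1
    · split_ifs with hj
      · rw [h _ hj.2]
      · rfl
    · split_ifs with hj
      · rw [h _ hj.2]
      · rfl

lemma pathCount_eq_jumpCount : pathCount G t R v = jumpCount G x y t R ∅ v := by
  induction hn : #R using Nat.strong_induction_on generalizing R v with
  | _ n ih =>
    subst hn
    rcases R.eq_empty_or_nonempty with rfl | hR
    · simp [pathCount_empty, jumpCount_empty]
    · rw [pathCount_of_nonempty hR, jumpCount_of_nonempty hR, sum_empty, add_zero]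
      exact sum_congr rfl fun u hu => ih _ (card_erase_lt_of_mem (mem_filter.1 hu).1) rfl

/-- An extra edge with an end that has been left behind can no longer be used. -/
lemma jumpCount_eq_zero {j : ι} (hj : j ∈ J) (h : ¬ (x j ∈ insert v R ∧ y j ∈ insert v R)) :
    jumpCount G x y t R J v = 0 := by
  induction hn : #R using Nat.strong_induction_on generalizing R J v with
  | _ n ih =>
    subst hn
    rcases R.eq_empty_or_nonempty with rfl | hR
    · rw [jumpCount_empty, if_neg]
      rintro ⟨rfl, -⟩
      simp at hj
    · have step {u : V} {J' : Finset ι} (hu : u ∈ R) (hJ' : j ∈ J') :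
          jumpCount G x y t (R.erase u) J' u = 0 := by
        refine ih _ (card_erase_lt_of_mem hu) hJ' ?_ rfl
        rw [insert_erase hu]
        exact fun h' => h ⟨mem_insert_of_mem h'.1, mem_insert_of_mem h'.2⟩
      rw [jumpCount_of_nonempty hR, sum_eq_zero fun u hu => step (mem_filter.1 hu).1 hj,
        zero_add]
      refine sum_eq_zero fun i hi => ?_
      -- Using `j` itself now would require both its ends in `insert v R`; using another extra edge
      -- leaves `j` pending and falls under the induction.
      by_cases hij : j = i
      · subst hij
        rw [if_neg, if_neg, add_zero]
        · rintro ⟨rfl, h'⟩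
          exact h ⟨mem_insert_of_mem h', mem_insert_self _ _⟩
        · rintro ⟨rfl, h'⟩
          exact h ⟨mem_insert_self _ _, mem_insert_of_mem h'⟩
      · have hJ' : j ∈ J.erase i := mem_erase.2 ⟨hij, hj⟩
        split_ifs with h1 h2 h2
        · rw [step h1.2 hJ', step h2.2 hJ', add_zero]
        · rw [step h1.2 hJ', add_zero]
        · rw [step h2.2 hJ', add_zero]
        · rfl

/-- `jumpCount` computed on lists, with a cut-off for extra edges that can no longer be used. -/
def jumpEval (adj : V → V → Bool) (x y : ι → V) (t : V) : ℕ → List V → List ι → V → ℕ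
  | 0, _, J, v => bif J.isEmpty && decide (v = t) then 1 else 0
  | n + 1, R, J, v =>
    bif J.all fun j => (v :: R).contains (x j) && (v :: R).contains (y j) then
      ((R.filter (adj v)).map fun u => jumpEval adj x y t n (R.erase u) J u).sum +
      (J.map fun j => (bif decide (v = x j) && R.contains (y j) then
          jumpEval adj x y t n (R.erase (y j)) (J.erase j) (y j) else 0) +
        (bif decide (v = y j) && R.contains (x j) then
          jumpEval adj x y t n (R.erase (x j)) (J.erase j) (x j) else 0)).sum
    else 0

/-- The list form is what the kernel computes; its cut-off loses nothing by `jumpCount_eq_zero`. -/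
lemma jumpCount_toFinset (R : List V) (hR : R.Nodup) (J : List ι) (hJ : J.Nodup) :
    jumpCount G x y t R.toFinset J.toFinset v =
      jumpEval (fun a b => decide (G.Adj a b)) x y t R.length R J v := by
  induction hn : R.length generalizing R J v with
  | zero =>
    obtain rfl := List.length_eq_zero_iff.1 hn
    rw [List.toFinset_nil, jumpCount_empty, jumpEval]
    cases J <;> by_cases h : v = t <;> simp [h]
  | succ n ih =>
    have hR' : R.toFinset.Nonempty := by
      rw [List.toFinset_nonempty_iff]
      rintro rfl
      simp at hn
    rw [jumpEval]
    cases hc : J.all fun j => (v :: R).contains (x j) && (v :: R).contains (y j) with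
    | false =>
      rw [List.all_eq_false] at hc
      obtain ⟨j, hj, h⟩ := hc
      rw [cond_false]
      refine jumpCount_eq_zero (List.mem_toFinset.2 hj) fun h' => h ?_
      simpa using h'
    | true =>
      have ih' {u : V} (hu : u ∈ R) (J : List ι) (hJ : J.Nodup) :
          jumpCount G x y t (R.toFinset.erase u) J.toFinset u =
            jumpEval (fun a b => decide (G.Adj a b)) x y t n (R.erase u) J u := by
        rw [← ih _ (hR.erase u) J hJ (by rw [List.length_erase_of_mem hu, hn]; rfl)]
        congr 1
        ext w
        simp [hR.mem_erase_iff]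
      have hJe (j : ι) : J.toFinset.erase j = (J.erase j).toFinset := by
        ext w
        simp [hJ.mem_erase_iff]
      rw [cond_true, jumpCount_of_nonempty hR']
      congr 1
      · rw [← List.sum_toFinset _ (hR.filter _), List.toFinset_filter]
        refine sum_congr (by simp) fun u hu => ?_
        exact ih' (by simpa using (mem_filter.1 hu).1) J hJ
      · rw [← List.sum_toFinset _ hJ]
        refine sum_congr rfl fun j _ => ?_
        rw [hJe]
        congr 1
        · by_cases h : v = x j ∧ y j ∈ R
          · simp [h, ih' h.2 _ (hJ.erase j)]
          · rw [if_neg (by simpa using h)]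
            have : (decide (v = x j) && R.contains (y j)) = false := by simpa using h
            rw [this, cond_false]
        · by_cases h : v = y j ∧ x j ∈ R
          · simp [h, ih' h.2 _ (hJ.erase j)]
          · rw [if_neg (by simpa using h)]
            have : (decide (v = y j) && R.contains (x j)) = false := by simpa using h
            rw [this, cond_false]

end JumpCount

/-! ### Attaching copies of a two-terminal graph, and degrees -/

section AttachCopies

variable {V ι W : Type*}

/-- The graph obtained from `G` by adding, for each index `j`, a copy of `T`, and joining the
vertices `r` and `s` of that copy to the vertices `x j` and `y j`. -/
def attachCopies (G : SimpleGraph V) (x y : ι → V) (T : SimpleGraph W) (r s : W) :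
    SimpleGraph (V ⊕ ι × W) where
  Adj
    | .inl u, .inl v => G.Adj u v
    | .inl u, .inr (j, a) => u = x j ∧ a = r ∨ u = y j ∧ a = s
    | .inr (j, a), .inl u => u = x j ∧ a = r ∨ u = y j ∧ a = s
    | .inr (i, a), .inr (j, b) => i = j ∧ T.Adj a b
  symm := ⟨by
    rintro (u | ⟨i, a⟩) (v | ⟨j, b⟩) h
    · exact h.symm
    · exact h
    · exact h
    · exact ⟨h.1.symm, h.2.symm⟩⟩
  loopless := ⟨by
    rintro (u | ⟨i, a⟩) h
    · exact h.ne rfl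
    · exact h.2.ne rfl⟩

variable {G : SimpleGraph V} {x y : ι → V} {T : SimpleGraph W} {r s : W} {u v : V} {i j : ι}
  {a b : W}

@[simp] lemma attachCopies_inl_inl : (attachCopies G x y T r s).Adj (.inl u) (.inl v) ↔ G.Adj u v := .rfl

@[simp] lemma attachCopies_inl_inr : (attachCopies G x y T r s).Adj (.inl u) (.inr (j, a)) ↔
    u = x j ∧ a = r ∨ u = y j ∧ a = s := .rfl

@[simp] lemma attachCopies_inr_inl : (attachCopies G x y T r s).Adj (.inr (j, a)) (.inl u) ↔
    u = x j ∧ a = r ∨ u = y j ∧ a = s := .rfl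

@[simp] lemma attachCopies_inr_inr : (attachCopies G x y T r s).Adj (.inr (i, a)) (.inr (j, b)) ↔
    i = j ∧ T.Adj a b := .rfl

variable [DecidableEq V] [DecidableEq ι] [DecidableEq W] [DecidableRel G.Adj] [DecidableRel T.Adj]

instance : DecidableRel (attachCopies G x y T r s).Adj
  | .inl u, .inl v => inferInstanceAs (Decidable (G.Adj u v))
  | .inl u, .inr (j, a) => inferInstanceAs (Decidable (u = x j ∧ a = r ∨ u = y j ∧ a = s))
  | .inr (j, a), .inl u => inferInstanceAs (Decidable (u = x j ∧ a = r ∨ u = y j ∧ a = s))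
  | .inr (i, a), .inr (j, b) => inferInstanceAs (Decidable (i = j ∧ T.Adj a b))

lemma degree_attachCopies_inl [Fintype V] [Fintype ι] [Fintype W] (hrs : r ≠ s) (v : V) :
    (attachCopies G x y T r s).degree (.inl v) = G.degree v + #{j | x j = v} + #{j | y j = v} := by
  have : (attachCopies G x y T r s).neighborFinset (.inl v) =
      (G.neighborFinset v).disjSum
        (univ.filter (x · = v) ×ˢ {r} ∪ univ.filter (y · = v) ×ˢ {s} : Finset (ι × W)) := by
    ext (u | ⟨j, a⟩) <;> simp [eq_comm]
  rw [← SimpleGraph.card_neighborFinset_eq_degree, this, card_disjSum, card_union_of_disjoint]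
  · simp [add_assoc]
  · rw [disjoint_left]
    rintro ⟨j, a⟩ h1 h2
    simp only [mem_product, mem_singleton] at h1 h2
    exact hrs (h1.2.symm.trans h2.2)

lemma degree_attachCopies_inr [Fintype V] [Fintype ι] [Fintype W] (hxy : x j ≠ y j) (a : W) :
    (attachCopies G x y T r s).degree (.inr (j, a)) =
      T.degree a + (if a = r then 1 else 0) + (if a = s then 1 else 0) := by
  have : (attachCopies G x y T r s).neighborFinset (.inr (j, a)) =
      ((if a = r then {x j} else ∅) ∪ (if a = s then {y j} else ∅) : Finset V).disjSum
        ({j} ×ˢ T.neighborFinset a) := by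
    ext (u | ⟨i, b⟩)
    · by_cases h1 : a = r <;> by_cases h2 : a = s <;> simp [h1, h2]
      all_goals grind
    · simp [eq_comm, and_comm]
  rw [← SimpleGraph.card_neighborFinset_eq_degree, this, card_disjSum, card_union_of_disjoint]
  · split_ifs <;> simp <;> omega
  · split_ifs <;> simp [hxy]

end AttachCopies

/-! ### Attached copies as compulsory edges -/

section AttachCopiesCount

variable {V ι W : Type*} [DecidableEq V] [DecidableEq ι] [DecidableEq W] [Fintype W]
  {G : SimpleGraph V} [DecidableRel G.Adj] {x y : ι → V} {T : SimpleGraph W}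
  [DecidableRel T.Adj] {r s : W} {t v : V} {R : Finset V} {J : Finset ι}

/-- A path that enters a copy of `T` at `a`, with `z` the only vertex still to be visited that is
joined to this copy, runs through the whole copy and then goes on from `z`. -/
lemma pathCount_attachCopies_inr (hR : R.Nonempty) {j : ι} (hj : j ∈ J) {a b : W} {z : V}
    (h : ∀ u ∈ R, ∀ c, (attachCopies G x y T r s).Adj (.inr (j, c)) (.inl u) ↔ c = b ∧ u = z) :
    pathCount (attachCopies G x y T r s) (.inl t) (R.disjSum ((J ×ˢ univ).erase (j, a)))
      (.inr (j, a)) = if z ∈ R then pathCount T b (univ.erase a) a *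
        pathCount (attachCopies G x y T r s) (.inl t) ((R.erase z).disjSum (J.erase j ×ˢ univ))
          (.inl z) else 0 := by
  obtain ⟨f, hf⟩ : ∃ f : W ↪ V ⊕ ι × W, ∀ c, f c = .inr (j, c) :=
    ⟨⟨fun c => .inr (j, c), fun c d h => by simpa using h⟩, fun _ => rfl⟩
  have hset : R.disjSum ((J ×ˢ univ).erase (j, a)) =
      (univ.erase a).map f ∪ R.disjSum (J.erase j ×ˢ univ) := by
    ext (u | ⟨i, c⟩)
    · simp [hf]
    · by_cases hij : i = j
      · subst hij; simp [hf, hj]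
      · simp [hf, hij, Ne.symm hij]
  have hdis : Disjoint ((univ.erase a).map f) (R.disjSum (J.erase j ×ˢ univ)) := by
    rw [disjoint_left]
    rintro (u | ⟨i, c⟩) h1 h2
    · simp [hf] at h1
    · simp only [mem_map, mem_erase, mem_univ, hf, Sum.inr.injEq,
        Prod.mk.injEq, inr_mem_disjSum, mem_product] at h1 h2
      obtain ⟨_, _, rfl, _⟩ := h1
      exact h2.1.1 rfl
  have hadj : ∀ c ∈ insert (f a) ((univ.erase a).map f), ∀ w ∈ R.disjSum (J.erase j ×ˢ univ),
      (attachCopies G x y T r s).Adj c w ↔ c = f b ∧ w = .inl z := by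
    intro c hc w hw
    rw [← map_insert, mem_map] at hc
    obtain ⟨c, -, rfl⟩ := hc
    rcases w with u | ⟨i, d⟩
    · rw [inl_mem_disjSum] at hw
      simpa [hf] using h u hw c
    · have hij : j ≠ i := by
        rintro rfl
        simp at hw
      simp [hf, hij]
  rw [hset]
  rw [← hf a]
  split_ifs with hz
  · rw [pathCount_union (s := f b) (y := .inl z) hdis (by simp) (by simpa using hz) hadj]
    congr 1
    · exact pathCount_map f (by simp [hf])
    · congr 1
      ext (u | ⟨i, c⟩) <;> simp
  -- If `z` is already used, no edge leads from the copy to the remaining vertices, and `R` still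
  -- contains some.
  · rw [union_comm]
    refine pathCount_eq_zero_of_not_adj ?_ hdis.symm ?_
    · obtain ⟨u, hu⟩ := hR
      exact ⟨.inl u, by simpa using hu⟩
    · intro w hw c hc hcw
      obtain ⟨-, rfl⟩ := (hadj c hc w hw).1 hcw
      exact hz (by simpa using hw)

/-- Each attached copy of `T` acts as an extra edge that has to be used, and contributes a factor
to the number of spanning paths. -/
theorem pathCount_attachCopies (hxy : ∀ j, x j ≠ y j) (hv : v ∉ R) :
    pathCount (attachCopies G x y T r s) (.inl t) (R.disjSum (J ×ˢ univ)) (.inl v) =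
      pathCount T s (univ.erase r) r ^ #J * jumpCount G x y t R J v := by
  induction hn : #R using Nat.strong_induction_on generalizing R J v with
  | _ n ih =>
    subst hn
    rcases R.eq_empty_or_nonempty with rfl | hR
    · rw [jumpCount_empty]
      rcases J.eq_empty_or_nonempty with rfl | hJ
      · have : (∅ : Finset V).disjSum ((∅ : Finset ι) ×ˢ (univ : Finset W)) = ∅ := by simp
        rw [this, pathCount_empty]
        simp
      -- Some copy is unvisited but no base vertex remains, so the path would end inside a copy and
      -- not in `.inl t`.
      · rw [if_neg (fun h => hJ.ne_empty h.1), mul_zero]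
        refine pathCount_eq_zero_of_notMem ?_ (by simp)
        obtain ⟨j, hj⟩ := hJ
        exact ⟨.inr (j, r), by simpa using hj⟩
    · have hne : (R.disjSum (J ×ˢ (univ : Finset W))).Nonempty := by
        obtain ⟨u, hu⟩ := hR
        exact ⟨.inl u, by simpa using hu⟩
      rw [pathCount_of_nonempty hne, sum_filter, sum_disjSum, jumpCount_of_nonempty hR, mul_add]
      congr 1
      · rw [sum_filter, mul_sum]
        refine sum_congr rfl fun u hu => ?_
        simp only [attachCopies_inl_inl, mul_ite, mul_zero]
        refine if_congr .rfl ?_ rfl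
        rw [← ih _ (card_erase_lt_of_mem hu) (notMem_erase _ _) rfl]
        congr 1
        ext (w | ⟨i, c⟩) <;> simp
      · rw [sum_product, mul_sum]
        refine sum_congr rfl fun j hj => ?_
        have herase (c : W) : (R.disjSum (J ×ˢ (univ : Finset W))).erase (.inr (j, c)) =
            R.disjSum ((J ×ˢ univ).erase (j, c)) := by
          ext (w | ⟨i, d⟩) <;> simp
        have hpow (m : ℕ) : pathCount T s (univ.erase r) r * (pathCount T s (univ.erase r) r ^
            #(J.erase j) * m) = pathCount T s (univ.erase r) r ^ #J * m := by
          rw [← mul_assoc, ← pow_succ', card_erase_add_one hj]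
        have h1 (hvx : v = x j) : pathCount (attachCopies G x y T r s) (.inl t)
            (R.disjSum ((J ×ˢ univ).erase (j, r))) (.inr (j, r)) =
              pathCount T s (univ.erase r) r ^ #J *
                if y j ∈ R then jumpCount G x y t (R.erase (y j)) (J.erase j) (y j) else 0 := by
          rw [pathCount_attachCopies_inr hR hj (b := s) (z := y j), mul_ite, mul_zero]
          · split_ifs with hy
            · rw [ih _ (card_erase_lt_of_mem hy) (notMem_erase _ _) rfl, hpow]
            · rfl
          · intro u hu c
            -- The entrance `x j = v` is spent, so the copy can only be left from `s` to `y j`.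
            have : u ≠ x j := fun h => hv (hvx ▸ h ▸ hu)
            simp [this, and_comm]
        have h2 (hvy : v = y j) : pathCount (attachCopies G x y T r s) (.inl t)
            (R.disjSum ((J ×ˢ univ).erase (j, s))) (.inr (j, s)) =
              pathCount T s (univ.erase r) r ^ #J *
                if x j ∈ R then jumpCount G x y t (R.erase (x j)) (J.erase j) (x j) else 0 := by
          rw [pathCount_attachCopies_inr hR hj (b := r) (z := x j), mul_ite, mul_zero]
          · split_ifs with hx
            · rw [ih _ (card_erase_lt_of_mem hx) (notMem_erase _ _) rfl, pathCount_symm, hpow]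
            · rfl
          · intro u hu c
            have : u ≠ y j := fun h => hv (hvy ▸ h ▸ hu)
            simp [this, and_comm]
        simp only [attachCopies_inl_inr, herase]
        rw [← sum_filter, mul_add, mul_ite, mul_ite, mul_zero]
        by_cases hvx : v = x j
        · have hvy : v ≠ y j := fun h => hxy j (hvx ▸ h)
          have : univ.filter (fun a : W => v = x j ∧ a = r ∨ v = y j ∧ a = s) = {r} := by
            ext a; simp [hvx, hxy j]
          rw [this, sum_singleton, h1 hvx]
          simp [hvx, hxy j]
        · by_cases hvy : v = y j
          · have : univ.filter (fun a : W => v = x j ∧ a = r ∨ v = y j ∧ a = s) = {s} := by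
              ext a; simp [hvy, (hxy j).symm]
            rw [this, sum_singleton, h2 hvy]
            simp [hvy, (hxy j).symm]
          · simp [hvx, hvy]

lemma pathCount_attachCopies_univ [Fintype V] [Fintype ι] (hxy : ∀ j, x j ≠ y j) :
    pathCount (attachCopies G x y T r s) (.inl t) (univ.erase (.inl v)) (.inl v) =
      pathCount T s (univ.erase r) r ^ Fintype.card ι *
        jumpCount G x y t (univ.erase v) univ v := by
  rw [← card_univ, ← pathCount_attachCopies hxy (notMem_erase _ _)]
  congr 1
  ext (u | ⟨i, c⟩) <;> simp

end AttachCopiesCount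

/-! ### Hamiltonian cycles through a fixed edge as Hamiltonian paths -/

section HamiltonianCycles

variable {V : Type*} {G : SimpleGraph V} {u t : V}

/-- A path is determined by its starting point and its edges. -/
lemma isPath_eq_of_edgeSet_eq {p q : G.Walk u t} (hp : p.IsPath) (hq : q.IsPath)
    (h : p.edgeSet = q.edgeSet) : p = q := by
  induction p with
  | nil => exact (SimpleGraph.Walk.isPath_iff_nil.1 hq).eq_nil.symm
  | @cons u v t hadj p ih =>
    cases q with
    | nil => exact (SimpleGraph.Walk.isPath_iff_nil.1 hp).eq_nil
    | @cons _ v' _ hadj' q =>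
      have hv : v = v' := by
        refine (hq.eq_snd_of_mem_edges ?_).trans (SimpleGraph.Walk.snd_cons _ _)
        rw [← SimpleGraph.Walk.mem_edgeSet, ← h]
        simp
      subst hv
      rw [SimpleGraph.Walk.cons_isPath_iff] at hp hq
      have hpe : s(u, v) ∉ p.edgeSet := fun h' =>
        hp.2 (SimpleGraph.Walk.fst_mem_support_of_mem_edges _ h')
      have hqe : s(u, v) ∉ q.edgeSet := fun h' =>
        hq.2 (SimpleGraph.Walk.fst_mem_support_of_mem_edges _ h')
      rw [SimpleGraph.Walk.edgeSet_cons, SimpleGraph.Walk.edgeSet_cons] at h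
      rw [ih hp.1 hq.1 (by
        rw [← Set.insert_sdiff_self_of_notMem hpe, h, Set.insert_sdiff_self_of_notMem hqe])]

variable [DecidableEq V]

lemma isHamiltonianCycle_reverse {c : G.Walk u u} (hc : c.IsHamiltonianCycle) :
    c.reverse.IsHamiltonianCycle := by
  have := hc.finite
  cases nonempty_fintype V
  rw [SimpleGraph.Walk.isHamiltonianCycle_iff_isCycle_and_length_eq] at hc ⊢
  exact ⟨hc.1.reverse, by rw [SimpleGraph.Walk.length_reverse, hc.2]⟩

/-- A Hamiltonian cycle through the edge `t u` can be traversed so that it starts with it. -/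
lemma exists_isHamiltonianCycle_snd_eq {v : V} {c : G.Walk v v} (hc : c.IsHamiltonianCycle)
    (he : s(t, u) ∈ c.edges) :
    ∃ c' : G.Walk t t, c'.IsHamiltonianCycle ∧ c'.snd = u ∧ c'.edgeSet = c.edgeSet := by
  have ht := hc.mem_support t
  have hes : (c.rotate t ht).edgeSet = c.edgeSet := by
    ext e
    exact (c.rotate_edges t ht).mem_iff
  have hc' : (c.rotate t ht).IsHamiltonianCycle := hc.rotate ht
  have he' : s(t, u) ∈ (c.rotate t ht).edges := (c.rotate_edges t ht).mem_iff.2 he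
  generalize c.rotate t ht = d at hes hc' he'
  by_cases hu : d.snd = u
  · exact ⟨d, hc', hu, hes⟩
  · refine ⟨d.reverse, isHamiltonianCycle_reverse hc', ?_, ?_⟩
    · rw [SimpleGraph.Walk.snd_reverse]
      cases d with
      | nil => simp at he'
      | @cons _ w _ h p =>
        have hp := ((SimpleGraph.Walk.cons_isCycle_iff _ _).1 hc'.isCycle).1
        simp only [SimpleGraph.Walk.snd_cons] at hu
        -- The edge is not the first one of the cycle, so it lies on the remaining path `p`, which
        -- ends in `t`; hence `u` is its penultimate vertex.
        have : s(t, u) ∈ p.edges := by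
          rw [SimpleGraph.Walk.edges_cons, List.mem_cons] at he'
          refine he'.resolve_left fun h' => hu ?_
          rcases (by simpa using h'.symm : w = u ∨ t = u ∧ w = t) with h | ⟨h, h'⟩
          exacts [h, h'.trans h]
        rw [hp.eq_penultimate_of_mem_edges this, SimpleGraph.Walk.penultimate_cons_of_not_nil]
        rintro hnil
        have := SimpleGraph.Walk.edges_eq_nil.2 hnil
        simp_all
    · rw [← hes]
      ext e
      simp [SimpleGraph.Walk.mem_edgeSet]

/-- If every Hamiltonian cycle contains the edge `u t`, then the Hamiltonian cycles correspond to
the Hamiltonian paths from `u` to `t` in the graph without that edge. -/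
theorem numHamiltonianCycles_eq_pathCount [Fintype V]
    {G' : SimpleGraph V} [DecidableRel G'.Adj] (hG' : G' = G.deleteEdges {s(u, t)})
    (hadj : G.Adj u t)
    (h : ∀ (v : V) (c : G.Walk v v), c.IsHamiltonianCycle → s(u, t) ∈ c.edges) :
    numHamiltonianCycles G = pathCount G' t (univ.erase u) u := by
  have hnot (p : G'.Walk u t) : s(u, t) ∉ p.edgeSet := fun hm => by
    have := p.edges_subset_edgeSet hm
    simp [hG'] at this
  have hle : G' ≤ G := hG' ▸ G.deleteEdges_le _
  let φ : {p : G'.Walk u t // p.IsHamiltonian} → Set (Sym2 V) := fun p => insert s(u, t) p.1.edgeSet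
  have hφ : Function.Injective φ := by
    rintro ⟨p, hp⟩ ⟨q, hq⟩ hpq
    refine Subtype.ext (isPath_eq_of_edgeSet_eq hp.isPath hq.isPath ?_)
    rw [← Set.insert_sdiff_self_of_notMem (hnot p), ← Set.insert_sdiff_self_of_notMem (hnot q)]
    exact congrArg (· \ {s(u, t)}) hpq
  have hrange : hamiltonianCycles G = Set.range φ := by
    ext C
    constructor
    · rintro ⟨v, c, hc, rfl⟩
      obtain ⟨d, hd, hsnd, hes⟩ := exists_isHamiltonianCycle_snd_eq hc
        (Sym2.eq_swap (a := u) ▸ h v c hc)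
      cases d with
      | nil => exact (hd.isCycle.ne_nil rfl).elim
      | @cons _ w _ hw p =>
        simp only [SimpleGraph.Walk.snd_cons] at hsnd
        subst hsnd
        have hp := (SimpleGraph.Walk.cons_isCycle_iff _ _).1 hd.isCycle
        have hpe : ∀ e ∈ p.edges, e ∈ G'.edgeSet := by
          intro e hep
          rw [hG', SimpleGraph.edgeSet_deleteEdges]
          refine ⟨p.edges_subset_edgeSet hep, ?_⟩
          rintro rfl
          rw [Sym2.eq_swap] at hep
          exact hp.2 hep
        refine ⟨⟨p.transfer G' hpe, ?_⟩, ?_⟩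
        · refine (hp.1.transfer hpe).isHamiltonian_of_mem fun x => ?_
          have := hd.isHamiltonian_tail.mem_support x
          simpa using this
        · rw [← hes, SimpleGraph.Walk.edgeSet_cons]
          simp only [φ, SimpleGraph.Walk.edgeSet_transfer]
          rw [Sym2.eq_swap]
    · rintro ⟨⟨p, hp⟩, rfl⟩
      refine ⟨t, .cons hadj.symm (p.mapLe hle), ⟨?_, ?_⟩, ?_⟩
      · rw [SimpleGraph.Walk.cons_isCycle_iff]
        refine ⟨hp.isPath.mapLe hle, ?_⟩
        rw [SimpleGraph.Walk.edges_mapLe_eq_edges, Sym2.eq_swap]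
        exact hnot p
      · intro x
        have := hp x
        simpa using this
      · rw [SimpleGraph.Walk.edgeSet_cons, SimpleGraph.Walk.edgeSet_mapLe_eq_edgeSet, Sym2.eq_swap]
  rw [numHamiltonianCycles, hrange, pathCount_univ_eq_card, ← Nat.card_coe_set_eq,
    Nat.card_range_of_injective hφ]

end HamiltonianCycles

/-! ### Invariance under isomorphism -/

section Isomorphism

variable {V W : Type*} [DecidableEq V] [DecidableEq W]

lemma numHamiltonianCycles_le_of_iso [Finite W] {G : SimpleGraph V} {H : SimpleGraph W}
    (e : G ≃g H) : numHamiltonianCycles G ≤ numHamiltonianCycles H := by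
  have hinj : Function.Injective (fun C : Set (Sym2 V) => Sym2.map e '' C) :=
    Set.image_injective.2 (Sym2.map.injective e.injective)
  rw [numHamiltonianCycles, ← Set.ncard_image_of_injective _ hinj]
  refine Set.ncard_le_ncard ?_ (Set.toFinite _)
  rintro _ ⟨_, ⟨v, c, hc, rfl⟩, rfl⟩
  exact ⟨e v, c.map e.toHom, hc.map (f := e.toHom) e.bijective,
    SimpleGraph.Walk.edgeSet_map e.toHom c⟩

lemma numHamiltonianCycles_congr [Finite V] [Finite W] {G : SimpleGraph V} {H : SimpleGraph W}
    (e : G ≃g H) : numHamiltonianCycles G = numHamiltonianCycles H :=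
  (numHamiltonianCycles_le_of_iso e).antisymm (numHamiltonianCycles_le_of_iso e.symm)

end Isomorphism

/-! ### Joining two graphs by two edges -/

section Join

variable {V W : Type*} [Fintype V] [Fintype W] [DecidableEq V] [DecidableEq W]
  {G : SimpleGraph V} [DecidableRel G.Adj] {T : SimpleGraph W} [DecidableRel T.Adj]
  {p q : V} {r s : W}

/-- The Hamiltonian cycles of two graphs joined by two edges are made up of a Hamiltonian path in
each of them. -/
theorem numHamiltonianCycles_attachCopies (hpq : p ≠ q) :
    numHamiltonianCycles (attachCopies G (fun _ : Unit => p) (fun _ => q) T r s) =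
      pathCount G q (univ.erase p) p * pathCount T s (univ.erase r) r := by
  classical
  set A := attachCopies G (fun _ : Unit => p) (fun _ => q) T r s with hA
  have hcross {v : V} {w : Unit × W} (c : A.Walk (.inl v) (.inr w)) :
      s(.inl p, .inr ((), r)) ∈ c.edges ∨ s(.inl q, .inr ((), s)) ∈ c.edges := by
    obtain ⟨⟨⟨a, b⟩, hab⟩, hd, ha, hb⟩ :=
      c.exists_boundary_dart (Set.range Sum.inl) (by simp) (by simp)
    obtain ⟨a, rfl⟩ := ha
    obtain b | ⟨⟨⟩, b⟩ := b
    · exact (hb ⟨b, rfl⟩).elim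
    · have he : s(.inl a, .inr ((), b)) ∈ c.edges := List.mem_map_of_mem hd
      rcases (hab : a = p ∧ b = r ∨ a = q ∧ b = s) with ⟨h1, h2⟩ | ⟨h1, h2⟩ <;> rw [h1, h2] at he
      · exact .inl he
      · exact .inr he
  have hall (v : V ⊕ Unit × W) (c : A.Walk v v) (hc : c.IsHamiltonianCycle) :
      s(.inl p, .inr ((), r)) ∈ c.edges := by
    rw [← (c.rotate_edges (.inl p) (hc.mem_support _)).mem_iff]
    have hc' := hc.rotate (v := .inl p) (hc.mem_support _)
    generalize c.rotate (.inl p) (hc.mem_support _) = d at hc'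
    -- Cut the cycle, based at `p`, at the vertex `r`: each half crosses between the sides, and a
    -- trail cannot use the edge `q s` twice, so one half uses `p r`.
    have hr := hc'.mem_support (.inr ((), r))
    have hsplit := d.take_spec hr
    have hnodup := hc'.isCycle.isTrail.edges_nodup
    rw [← hsplit, SimpleGraph.Walk.edges_append] at hnodup ⊢
    rcases hcross (d.takeUntil _ hr) with h1 | h1
    · exact List.mem_append_left _ h1
    · rcases hcross (d.dropUntil _ hr).reverse with h2 | h2 <;>
        rw [SimpleGraph.Walk.edges_reverse, List.mem_reverse] at h2
      · exact List.mem_append_right _ h2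
      · exact (List.disjoint_of_nodup_append hnodup h1 h2).elim
  have hadj : A.Adj (.inl p) (.inr ((), r)) := by simp [hA]
  rw [numHamiltonianCycles_eq_pathCount rfl hadj hall]
  obtain ⟨f, hf⟩ : ∃ f : V ↪ V ⊕ Unit × W, ∀ v, f v = .inl v :=
    ⟨⟨_, Sum.inl_injective⟩, fun _ => rfl⟩
  obtain ⟨g, hg⟩ : ∃ g : W ↪ V ⊕ Unit × W, ∀ w, g w = .inr ((), w) :=
    ⟨⟨fun w => .inr ((), w), fun _ _ h => by simpa using h⟩, fun _ => rfl⟩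
  have hset : univ.erase (.inl p) = (univ.erase p).map f ∪ univ.map g := by
    ext (v | ⟨⟨⟩, w⟩) <;> simp [hf, hg]
  -- With `p r` deleted, `q s` is the only crossing edge, so the path count splits into a product.
  rw [hset, ← hf p, ← hg r, pathCount_union (s := f q) (y := g s), ← map_erase, pathCount_map (G := G) f,
    pathCount_map (G := T) g, pathCount_symm (G := T)]
  · simp [hA, hf, hg]
  · simp [hA, hf, hg]
  · rw [disjoint_left]
    rintro (v | w) h1 h2
    · simp [hg] at h2
    · simp [hf] at h1
  · simp
  · simp
  · simp only [← map_insert, mem_map, mem_univ, true_and]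
    rintro _ ⟨v, -, rfl⟩ _ ⟨w, rfl⟩
    simp only [hf, hg, hA, SimpleGraph.deleteEdges_adj, attachCopies_inl_inr,
      Set.mem_singleton_iff, Sym2.eq_iff, Sum.inl.injEq, Sum.inr.injEq, Prod.mk.injEq, true_and,
      reduceCtorEq, and_false, or_false]
    grind

end Join

/-! ### Construction of the gadgets -/

section Gadgets

/-- There is a graph on `n` vertices with two terminals, of degree `d` except that the terminals
have degree `d - 1`, and with `N` Hamiltonian paths between the terminals. -/
def HasGadget (d n N : ℕ) : Prop :=
  ∃ (V : Type) (_ : Fintype V) (_ : DecidableEq V) (G : SimpleGraph V) (_ : DecidableRel G.Adj)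
    (p q : V), p ≠ q ∧ Fintype.card V = n ∧
      (∀ v, G.degree v + (if v = p then 1 else 0) + (if v = q then 1 else 0) = d) ∧
      pathCount G q (univ.erase p) p = N

variable {d n m c N M : ℕ}

lemma jumpCount_fin {G : SimpleGraph (Fin m)} [DecidableRel G.Adj] {x y : Fin c → Fin m}
    {p q : Fin m} : jumpCount G x y q (univ.erase p) univ p =
      jumpEval (fun a b => decide (G.Adj a b)) x y q (m - 1) ((List.finRange m).erase p)
        (List.finRange c) p := by
  have h := List.nodup_finRange m
  have h1 : univ.erase p = ((List.finRange m).erase p).toFinset := by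
    ext v
    simp [h.mem_erase_iff]
  have h2 : (univ : Finset (Fin c)) = (List.finRange c).toFinset := by
    ext v
    simp
  rw [h1, h2, jumpCount_toFinset _ (h.erase p) _ (List.nodup_finRange c),
    List.length_erase_of_mem (List.mem_finRange p), List.length_finRange]

/-- An empty family of extra edges lets `jumpEval` serve for plain path counts as well. -/
lemma HasGadget.of_fin (G : SimpleGraph (Fin m)) [DecidableRel G.Adj] (p q : Fin m) (hpq : p ≠ q)
    (hdeg : ∀ v, G.degree v + (if v = p then 1 else 0) + (if v = q then 1 else 0) = d)
    (hN : jumpEval (fun a b => decide (G.Adj a b)) (Fin.elim0 ·) (Fin.elim0 ·) q (m - 1)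
        ((List.finRange m).erase p) (List.finRange 0) p = N) : HasGadget d m N := by
  refine ⟨Fin m, inferInstance, inferInstance, G, inferInstance, p, q, hpq, Fintype.card_fin m,
    hdeg, ?_⟩
  rw [pathCount_eq_jumpCount (ι := Fin 0) (x := (Fin.elim0 ·)) (y := (Fin.elim0 ·)), ← hN,
    ← jumpCount_fin, univ_eq_empty (α := Fin 0)]

/-- Replacing extra edges of a graph by copies of a gadget. -/
lemma HasGadget.attach (hT : HasGadget d n N) (G : SimpleGraph (Fin m)) [DecidableRel G.Adj]
    (x y : Fin c → Fin m) (p q : Fin m) (hpq : p ≠ q) (hxy : ∀ j, x j ≠ y j)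
    (hdeg : ∀ v, G.degree v + #(univ.filter (x · = v)) + #(univ.filter (y · = v)) +
      (if v = p then 1 else 0) + (if v = q then 1 else 0) = d)
    (hM : jumpEval (fun a b => decide (G.Adj a b)) x y q (m - 1) ((List.finRange m).erase p)
        (List.finRange c) p = M) : HasGadget d (m + c * n) (N ^ c * M) := by
  obtain ⟨W, _, _, T, _, r, s, hrs, hn, hTdeg, hTN⟩ := hT
  refine ⟨Fin m ⊕ Fin c × W, inferInstance, inferInstance, attachCopies G x y T r s, inferInstance,
    .inl p, .inl q, by simpa using hpq, by simp [hn], ?_, ?_⟩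
  · rintro (v | ⟨j, a⟩)
    · rw [degree_attachCopies_inl hrs]
      simpa using hdeg v
    · rw [degree_attachCopies_inr (hxy j)]
      simpa using hTdeg a
  · rw [pathCount_attachCopies_univ hxy, hTN, jumpCount_fin, hM, Fintype.card_fin]

/-- Two gadgets joined by two edges form a regular graph. -/
lemma HasGadget.join {n' N' : ℕ} (h : HasGadget d n N) (h' : HasGadget d n' N')
    (hm : m = n + n') (hM : M = N * N') :
    ∃ (G : SimpleGraph (Fin m)) (_ : DecidableRel G.Adj),
      G.IsRegularOfDegree d ∧ numHamiltonianCycles G = M := by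
  classical
  obtain ⟨V, _, _, G, _, p, q, hpq, hn, hdeg, hN⟩ := h
  obtain ⟨W, _, _, T, _, r, s, hrs, hn', hdeg', hN'⟩ := h'
  let A := attachCopies G (fun _ : Unit => p) (fun _ => q) T r s
  have hcard : Fintype.card (V ⊕ Unit × W) = m := by simp [hn, hn', hm]
  refine ⟨A.overFin hcard, inferInstance, fun v => ?_, ?_⟩
  · obtain ⟨v, rfl⟩ := (A.overFinIso hcard).surjective v
    rw [SimpleGraph.Iso.degree_eq]
    obtain v | ⟨⟨⟩, a⟩ := v
    · rw [degree_attachCopies_inl hrs, ← hdeg v]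
      simp [filter_const, eq_comm, apply_ite Finset.card]
    · rw [degree_attachCopies_inr hpq, ← hdeg' a]
  · rw [← numHamiltonianCycles_congr (A.overFinIso hcard),
      numHamiltonianCycles_attachCopies hpq, hN, hN', hM]

/-- The graph on `Fin n` whose edges are the pairs in a list. -/
def graphOfEdges (L : List (Fin n × Fin n)) : SimpleGraph (Fin n) where
  Adj u v := u ≠ v ∧ ((u, v) ∈ L ∨ (v, u) ∈ L)
  symm := ⟨fun _ _ h => ⟨h.1.symm, h.2.symm⟩⟩
  loopless := ⟨fun _ h => h.1 rfl⟩

instance (L : List (Fin n × Fin n)) : DecidableRel (graphOfEdges L).Adj := fun u v =>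
  inferInstanceAs (Decidable (u ≠ v ∧ ((u, v) ∈ L ∨ (v, u) ∈ L)))

/-- The complete graph without the edges in a list. -/
abbrev completeMinus (L : List (Fin n × Fin n)) : SimpleGraph (Fin n) := (graphOfEdges L)ᶜ

lemma hasGadget_seven : HasGadget 6 7 120 :=
  .of_fin (completeMinus [(0, 1)]) 0 1 (by decide) (by decide +kernel) (by decide +kernel)

lemma hasGadget_eight : HasGadget 7 8 720 :=
  .of_fin (completeMinus [(0, 1)]) 0 1 (by decide) (by decide +kernel) (by decide +kernel)

lemma hasGadget_chain_six (k : ℕ) : HasGadget 6 (7 * (k + 1)) (120 * 24 ^ k) := by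
  induction k with
  | zero => exact hasGadget_seven
  | succ k ih =>
    -- The previous gadget replaces the edge between 2 and the terminal 1. The path must end 2, 1,
    -- and the other four vertices come in any order: 4! = 24.
    convert ih.attach (completeMinus [(0, 1), (1, 2)] : SimpleGraph (Fin 7)) ![2] ![1] 0 1
      (M := 24) (by decide) (by decide) (by decide +kernel) (by decide +kernel) using 1
    · ring
    · ring

lemma hasGadget_chain_seven (k : ℕ) : HasGadget 7 (8 * (k + 1)) (720 * 120 ^ k) := by
  induction k with
  | zero => exact hasGadget_eight
  | succ k ih =>
    convert ih.attach (completeMinus [(0, 1), (1, 2)] : SimpleGraph (Fin 8)) ![2] ![1] 0 1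
      (M := 120) (by decide) (by decide) (by decide +kernel) (by decide +kernel) using 1
    · ring
    · ring

/-- The extra edges are 0–10, 3–5 and 0–7; exactly two Hamiltonian paths from 5 to 7 use all three.
Here 32 = 11 + 3·7. -/
lemma hasGadget_core_six : HasGadget 6 32 (120 ^ 3 * 2) :=
  hasGadget_seven.attach (graphOfEdges (n := 11) 
    [(0, 1), (0, 4), (0, 6), (0, 9), (1, 3), (1, 4), (1, 5), (1, 7), (1, 10), (2, 3), (2,
     4), (2, 6), (2, 8), (2, 9), (2, 10), (3, 4), (3, 6), (3, 8), (4, 5), (4, 8), (5, 6),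
     (5, 9), (6, 7), (6, 10), (7, 8), (7, 9), (8, 9), (8, 10), (9, 10)]) 
    ![0, 3, 0] ![10, 5, 7] 5 7
    (by decide) (by decide) (by decide +kernel) (by decide +kernel)

/-- The extra edges are 4–9, 1–11, 9–11 and 0–4; exactly two Hamiltonian paths from 0 to 3 use all
four. Here 46 = 14 + 4·8. -/
lemma hasGadget_core_seven : HasGadget 7 46 (720 ^ 4 * 2) :=
  hasGadget_eight.attach (graphOfEdges (n := 14) 
    [(0, 5), (0, 7), (0, 10), (0, 12), (0, 13), (1, 2), (1, 5), (1, 8), (1, 10), (1, 12),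
     (1, 13), (2, 3), (2, 4), (2, 5), (2, 6), (2, 9), (2, 11), (3, 6), (3, 8), (3, 10), (3,
     12), (3, 13), (4, 6), (4, 7), (4, 10), (4, 13), (5, 6), (5, 7), (5, 8), (5, 12), (6,
     7), (6, 8), (6, 10), (7, 8), (7, 9), (7, 13), (8, 11), (8, 12), (9, 10), (9, 12), (9,
     13), (10, 11), (11, 12), (11, 13)]) 
    ![4, 1, 9, 0] ![9, 11, 11, 4] 0 3
    (by decide) (by decide) (by decide +kernel) (by decide +kernel)

end Gadgets

theorem mainTheorem5 (k : ℕ) :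
    (∃ (G : SimpleGraph (Fin (39 + 7 * k))) (_ : DecidableRel G.Adj),
      G.IsRegularOfDegree 6 ∧
        numHamiltonianCycles G = 2 ^ (3 * (k + 4) + 1) * 3 ^ (k + 4) * 5 ^ 4) ∧
    (∃ (G : SimpleGraph (Fin (54 + 8 * k))) (_ : DecidableRel G.Adj),
      G.IsRegularOfDegree 7 ∧
        numHamiltonianCycles G = 2 ^ (3 * (k + 7)) * 3 ^ (k + 10) * 5 ^ (k + 5)) := by
  refine ⟨hasGadget_core_six.join (hasGadget_chain_six k) (by ring) ?_,
    hasGadget_core_seven.join (hasGadget_chain_seven k) (by ring) ?_⟩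
  -- The total is 2·120⁴·24ᵏ here, and 2·720⁵·120ᵏ in degree 7.
  · rw [show 24 = 2 ^ 3 * 3 by norm_num, mul_pow, ← pow_mul]
    ring
  · rw [show 120 = 2 ^ 3 * 3 * 5 by norm_num, mul_pow, mul_pow, ← pow_mul]
    ring
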